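/- Four-qubit states are vectors $|\Psi\rangle\in(\mathbb C^2)^{\otimes 4}$. A three-qubit state is in the W class if it equals $A_1\otimes A_2\otimes A_3|\mathrm W\rangle$ with invertible $A_i\in GL_2(\mathbb C)$, where $|\mathrm W\rangle=\frac1{\sqrt3}(|001\rangle+|010\rangle+|100\rangle)$. The state $|\Psi\rangle$ has the irreducible $A|BCD$ form if for every qubit $A\in\{1,2,3,4\}$ and every invertible operator $A_1$ on that qubit, writing $A_1|\Psi\rangle=|0\rangle_A|\phi_0\rangle_{BCD}+|1\rangle_A|\phi_1\rangle_{BCD}$, both $|\phi_0\rangle$ and $|\phi_1\rangle$ are in the W class. A tree is a rooted tree of $+$ and $\otimes$ gates whose leaves are labelled by (not necessarily normalized) single-qubit vectors $\alpha|0\rangle+\beta|1\rangle$ of specified qubits, such that the children of a $+$ gate are on the same qubits as the gate and the qubit sets of the children of a $\otimes$ gate partition the qubit set of the gate; its size is its number of leaves, and the tree size of a state is the minimum size of a tree that describes it. Let $T_E$ be the tree with a $+$ gate over two $\otimes$ gates with two leaves each, $T_8$ the tree with a $\otimes$ gate over two trees $T_E$, and $T_8+T_8$ the tree with a $+$ gate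 over two trees $T_8$ (the assignment of the qubits to the leaves being free). If a four-qubit state $|\Psi\rangle$ has the irreducible $A|BCD$ form, then it is described by a tree of the form $T_8+T_8$ that is minimal, that is, no tree with fewer leaves describes $|\Psi\rangle$. Thus the tree size of $|\Psi\rangle$ is exactly $16$. -/

import Mathlib

/-- An `n`-qubit (ket) vector, given by its amplitudes in the computational basis: `ψ x` is the
coefficient of `|x₀ x₁ … xₙ₋₁⟩`. It need not be normalized. -/
abbrev QState (n : ℕ) : Type := (Fin n → Fin 2) → ℂ

namespace QState

/-- The local operator `M` on qubit `a` (identity on the other qubits), applied to `ψ`. -/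
def applyAt {n : ℕ} (a : Fin n) (M : Matrix (Fin 2) (Fin 2) ℂ) (ψ : QState n) : QState n :=
  fun x => ∑ b : Fin 2, M (x a) b * ψ (Function.update x a b)

/-- The product operator `M 0 ⊗ M 1 ⊗ … ⊗ M (n - 1)`, applied to `ψ`. -/
def applyLocal {n : ℕ} (M : Fin n → Matrix (Fin 2) (Fin 2) ℂ) (ψ : QState n) : QState n :=
  fun x => ∑ y : Fin n → Fin 2, (∏ i, M i (x i) (y i)) * ψ y

/-- The component of `ψ` along `|b⟩` of qubit `a`, a vector of the remaining `n` qubits: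
`ψ = |0⟩_a ⊗ component a 0 ψ + |1⟩_a ⊗ component a 1 ψ`. -/
def component {n : ℕ} (a : Fin (n + 1)) (b : Fin 2) (ψ : QState (n + 1)) : QState n :=
  fun y => ψ (a.insertNth (α := fun _ => Fin 2) b y)

/-- The state `|W⟩ = (|001⟩ + |010⟩ + |100⟩) / √3`. -/
noncomputable def wState : QState 3 :=
  fun x => if x = ![0, 0, 1] ∨ x = ![0, 1, 0] ∨ x = ![1, 0, 0] then 1 / (Real.sqrt 3 : ℂ) else 0

/-- The W class: the images of `|W⟩` under invertible local operators. -/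
def IsWClass (φ : QState 3) : Prop :=
  ∃ M : Fin 3 → Matrix.GeneralLinearGroup (Fin 2) ℂ,
    φ = applyLocal (fun i => (M i : Matrix (Fin 2) (Fin 2) ℂ)) wState

/-- Irreducible `A|BCD` form: for every qubit `A` and every invertible operator on that qubit, the
resulting vector `|0⟩_A |φ₀⟩ + |1⟩_A |φ₁⟩` has both `φ₀` and `φ₁` in the W class. -/
def HasIrreducibleForm (ψ : QState 4) : Prop :=
  ∀ (a : Fin 4) (M : Matrix.GeneralLinearGroup (Fin 2) ℂ),
    IsWClass (component a 0 (applyAt a (M : Matrix (Fin 2) (Fin 2) ℂ) ψ)) ∧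
      IsWClass (component a 1 (applyAt a (M : Matrix (Fin 2) (Fin 2) ℂ) ψ))

end QState

/-- Rooted trees of `⊗` and `+` gates over `n` qubits. A leaf carries a qubit `i` and a
single-qubit vector `v 0 |0⟩ + v 1 |1⟩`, not necessarily normalized. Gates have any
number `k + 2 ≥ 2` of children. -/
inductive QTree (n : ℕ) : Type
  | leaf (i : Fin n) (v : Fin 2 → ℂ) : QTree n
  | add (k : ℕ) (c : Fin (k + 2) → QTree n) : QTree n
  | tensor (k : ℕ) (c : Fin (k + 2) → QTree n) : QTree n

namespace QTree

/-- The size of a tree: its number of leaves. -/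
def size {n : ℕ} : QTree n → ℕ
  | leaf _ _ => 1
  | add _ c => ∑ j, (c j).size
  | tensor _ c => ∑ j, (c j).size

/-- `t.IsOn S`: the tree is well formed and represents a vector of the qubits in `S`. The children
of a `+` gate live on the same qubits as the gate; the qubit sets of the children of a `⊗` gate
partition the qubit set of the gate. -/
def IsOn {n : ℕ} : QTree n → Finset (Fin n) → Prop
  | leaf i _, S => S = {i}
  | add _ c, S => ∀ j, (c j).IsOn S
  | tensor k c, S => ∃ P : Fin (k + 2) → Finset (Fin n),
      Pairwise (fun j l => Disjoint (P j) (P l)) ∧ S = Finset.univ.biUnion P ∧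
        ∀ j, (c j).IsOn (P j)

/-- The vector represented by a tree: the amplitude of the bit string `x`. For a tree on the
qubits in `S` it depends only on the bits `x i` with `i ∈ S`. -/
def eval {n : ℕ} : QTree n → QState n
  | leaf i v => fun x => v (x i)
  | add _ c => fun x => ∑ j, (c j).eval x
  | tensor _ c => fun x => ∏ j, (c j).eval x

/-- The tree `t` describes the `n`-qubit vector `ψ`. -/
def Describes {n : ℕ} (t : QTree n) (ψ : QState n) : Prop :=
  t.IsOn Finset.univ ∧ t.eval = ψ

/-- `t` is a minimal tree of `ψ`: it describes `ψ`, and no tree with fewer leaves does. -/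
def IsMinimalFor {n : ℕ} (t : QTree n) (ψ : QState n) : Prop :=
  t.Describes ψ ∧ ∀ t' : QTree n, t'.Describes ψ → t.size ≤ t'.size

/-- The tree `T_E` of two-qubit entangled states: a `+` gate over two `⊗` gates, each with two
leaves. -/
def IsTE {n : ℕ} (t : QTree n) : Prop :=
  ∃ (i j i' j' : Fin n) (u v u' v' : Fin 2 → ℂ),
    t = add 0 ![tensor 0 ![leaf i u, leaf j v], tensor 0 ![leaf i' u', leaf j' v']]

/-- The tree `T₈`: a `⊗` gate over two trees `T_E`. -/
def IsT8 {n : ℕ} (t : QTree n) : Prop :=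
  ∃ a b : QTree n, a.IsTE ∧ b.IsTE ∧ t = tensor 0 ![a, b]

/-- The tree `T₈ + T₈`: a `+` gate over two trees `T₈`. -/
def IsT8AddT8 {n : ℕ} (t : QTree n) : Prop :=
  ∃ a b : QTree n, a.IsT8 ∧ b.IsT8 ∧ t = add 0 ![a, b]

end QTree

/-- The tree size of `ψ`: the minimum size of a tree that describes `ψ`. -/
noncomputable def treeSize {n : ℕ} (ψ : QState n) : ℕ :=
  sInf {s : ℕ | ∃ t : QTree n, t.Describes ψ ∧ t.size = s}

/-! The hypothesis is used as follows: contracting any qubit with any nonzero functional leaves a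
W-class vector (`HasIrreducibleForm.contract`). The determinant of a slice of a three-qubit array is
a binary quadratic form whose discriminant is the hyperdeterminant. For W-class vectors this form is
a nonzero perfect square, for each choice of the sliced qubit. Hence a W-class vector is neither a
product over a bipartition nor a combination of two product vectors.

Lower bound: if a tree has at most 15 leaves, some functional on one qubit annihilates enough of it
to leave zero, a product over a bipartition, or a combination of two products. The bookkeeping rests
on two facts: a sum on `S` costs at least `2 * S.card` leaves, and a four-qubit vector with at most
7 leaves splits off a qubit (`exists_eq_leaf_mul`).

Upper bound: contracting qubit 0 with `v` gives a pencil of W-class vectors. On each other qubit the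
double root of the slice determinant is an invertible linear function of `v`, because a biquadratic
form of this kind is the square of a bilinear form (`exists_bilinear_sq`). In the bases given by
these linear maps all degenerate directions equal `v`. The array is then killed by `v ⊗ v ⊗ v` on
the triples 012, 013 and 023, which leaves only combinations of two singlet pairings
(`exists_singlets`). Undoing the base change gives a sum of two products of two-qubit vectors, which
is a tree `T₈ + T₈` with 16 leaves. -/

namespace QState

/-! ### Invariants and degeneracies of W-class vectors -/

/-- The contraction of qubit `a` of `ψ` with the functional `w`. -/
def contract {n : ℕ} (a : Fin (n + 1)) (w : Fin 2 → ℂ) (ψ : QState (n + 1)) : QState n :=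
  fun y => ∑ c, w c * ψ (a.insertNth (α := fun _ => Fin 2) c y)

/-- Cayley's hyperdeterminant of a `2 × 2 × 2` array. -/
def hyperdet (f : Fin 2 → Fin 2 → Fin 2 → ℂ) : ℂ :=
  (f 0 0 0 * f 1 1 1 + f 0 1 1 * f 1 0 0 - f 0 0 1 * f 1 1 0 - f 0 1 0 * f 1 0 1) ^ 2
    - 4 * (f 0 0 0 * f 0 1 1 - f 0 0 1 * f 0 1 0) * (f 1 0 0 * f 1 1 1 - f 1 0 1 * f 1 1 0)

/-- The determinant of the contraction of the first index of a `2 × 2 × 2` array with `w`. -/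
def sliceDet (f : Fin 2 → Fin 2 → Fin 2 → ℂ) (w : Fin 2 → ℂ) : ℂ :=
  (w 0 * f 0 0 0 + w 1 * f 1 0 0) * (w 0 * f 0 1 1 + w 1 * f 1 1 1)
    - (w 0 * f 0 0 1 + w 1 * f 1 0 1) * (w 0 * f 0 1 0 + w 1 * f 1 1 0)

/-- The amplitudes of a three-qubit vector as an array. -/
def arr (φ : QState 3) (i j k : Fin 2) : ℂ := φ ![i, j, k]

/-- The array with the second index moved to the front. -/
def rot (f : Fin 2 → Fin 2 → Fin 2 → ℂ) (j i k : Fin 2) : ℂ := f i j k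

/-- The array with the third index moved to the front. -/
def rot' (f : Fin 2 → Fin 2 → Fin 2 → ℂ) (k i j : Fin 2) : ℂ := f i j k

theorem IsWClass.exists_form {φ : QState 3} (h : IsWClass φ) :
    ∃ a a' b b' c c' : Fin 2 → ℂ, a 0 * a' 1 - a 1 * a' 0 ≠ 0 ∧ b 0 * b' 1 - b 1 * b' 0 ≠ 0 ∧
      c 0 * c' 1 - c 1 * c' 0 ≠ 0 ∧
      ∀ i j k, arr φ i j k = a' i * b j * c k + a i * b' j * c k + a i * b j * c' k := by
  obtain ⟨M, rfl⟩ := h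
  have hk : (1 / (Real.sqrt 3 : ℂ)) ≠ 0 := by
    have : (Real.sqrt 3 : ℂ) ≠ 0 := by
      exact_mod_cast (Real.sqrt_pos.2 (by norm_num : (0 : ℝ) < 3)).ne'
    exact one_div_ne_zero this
  have hd : ∀ i, (M i).1 0 0 * (1 / (Real.sqrt 3 : ℂ) * (M i).1 1 1)
      - (M i).1 1 0 * (1 / (Real.sqrt 3 : ℂ) * (M i).1 0 1) ≠ 0 := by
    intro i
    have h1 : (M i).1.det ≠ 0 := (Matrix.isUnits_det_units (M i)).ne_zero
    rw [Matrix.det_fin_two] at h1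
    intro h2
    apply mul_ne_zero hk h1
    linear_combination h2
  -- Unprimed vectors are the images of `|0⟩`, primed ones those of `|1⟩`; each term has exactly one
  -- primed factor, so the scalar 1/√3 is absorbed there.
  refine ⟨fun i => (M 0).1 i 0, fun i => 1 / (Real.sqrt 3 : ℂ) * (M 0).1 i 1,
    fun i => (M 1).1 i 0, fun i => 1 / (Real.sqrt 3 : ℂ) * (M 1).1 i 1,
    fun i => (M 2).1 i 0, fun i => 1 / (Real.sqrt 3 : ℂ) * (M 2).1 i 1, hd 0, hd 1, hd 2, ?_⟩
  intro i j k
  have key : ∀ F : (Fin 3 → Fin 2) → ℂ, ∑ y, F y * wState y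
      = 1 / (Real.sqrt 3 : ℂ) * (F ![0, 0, 1] + F ![0, 1, 0] + F ![1, 0, 0]) := by
    intro F
    have : ∀ y, F y * wState y = (if y = ![0, 0, 1] then F y * (1 / (Real.sqrt 3 : ℂ)) else 0)
        + (if y = ![0, 1, 0] then F y * (1 / (Real.sqrt 3 : ℂ)) else 0)
        + (if y = ![1, 0, 0] then F y * (1 / (Real.sqrt 3 : ℂ)) else 0) := by
      intro y
      unfold wState
      by_cases h1 : y = ![0, 0, 1]
      · subst h1; simp
      by_cases h2 : y = ![0, 1, 0]
      · subst h2; simp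
      by_cases h3 : y = ![1, 0, 0]
      · subst h3; simp
      simp [h1, h2, h3]
    simp only [this, Finset.sum_add_distrib, Finset.sum_ite_eq', Finset.mem_univ, if_true]
    ring
  simp only [arr, applyLocal, key, Fin.prod_univ_three]
  simp
  ring

theorem IsWClass.hyperdet_eq_zero {φ : QState 3} (h : IsWClass φ) : hyperdet (arr φ) = 0 := by
  obtain ⟨a, a', b, b', c, c', -, -, -, e⟩ := h.exists_form
  simp only [hyperdet, e]
  ring

theorem exists_dot_ne_zero {a a' : Fin 2 → ℂ} (h : a 0 * a' 1 - a 1 * a' 0 ≠ 0) :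
    ∃ w : Fin 2 → ℂ, w 0 * a 0 + w 1 * a 1 ≠ 0 :=
  ⟨![a' 1, -a' 0], by simpa [mul_comm, sub_eq_add_neg] using h⟩

/-- In the form of `exists_form` the slice determinant is `-(det b b') (det c c') (w · a)²`, so it
suffices that `w` does not annihilate `a`. -/
theorem IsWClass.sliceDet_ne {φ : QState 3} (h : IsWClass φ) : ∃ w, sliceDet (arr φ) w ≠ 0 := by
  obtain ⟨a, a', b, b', c, c', ha, hb, hc, e⟩ := h.exists_form
  obtain ⟨w, hw⟩ := exists_dot_ne_zero ha
  refine ⟨w, fun h0 => mul_ne_zero (mul_ne_zero hb hc) (pow_ne_zero 2 hw) ?_⟩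
  simp only [sliceDet, e] at h0
  linear_combination -h0

theorem IsWClass.sliceDet_rot_ne {φ : QState 3} (h : IsWClass φ) :
    ∃ w, sliceDet (rot (arr φ)) w ≠ 0 := by
  obtain ⟨a, a', b, b', c, c', ha, hb, hc, e⟩ := h.exists_form
  obtain ⟨w, hw⟩ := exists_dot_ne_zero hb
  refine ⟨w, fun h0 => mul_ne_zero (mul_ne_zero ha hc) (pow_ne_zero 2 hw) ?_⟩
  simp only [sliceDet, rot, e] at h0
  linear_combination -h0

theorem IsWClass.sliceDet_rot'_ne {φ : QState 3} (h : IsWClass φ) :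
    ∃ w, sliceDet (rot' (arr φ)) w ≠ 0 := by
  obtain ⟨a, a', b, b', c, c', ha, hb, hc, e⟩ := h.exists_form
  obtain ⟨w, hw⟩ := exists_dot_ne_zero hc
  refine ⟨w, fun h0 => mul_ne_zero (mul_ne_zero ha hb) (pow_ne_zero 2 hw) ?_⟩
  simp only [sliceDet, rot', e] at h0
  linear_combination -h0

/-- The functionals along which a W-class vector degenerates. -/
theorem IsWClass.exists_kernel {φ : QState 3} (h : IsWClass φ) :
    ∃ u v w : Fin 2 → ℂ, u ≠ 0 ∧ v ≠ 0 ∧ w ≠ 0 ∧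
      (∀ k, ∑ i, ∑ j, u i * v j * arr φ i j k = 0) ∧
      (∀ j, ∑ i, ∑ k, u i * w k * arr φ i j k = 0) ∧
      (∀ i, ∑ j, ∑ k, v j * w k * arr φ i j k = 0) := by
  obtain ⟨a, a', b, b', c, c', ha, hb, hc, e⟩ := h.exists_form
  have ne : ∀ a a' : Fin 2 → ℂ, a 0 * a' 1 - a 1 * a' 0 ≠ 0 → (![a 1, -a 0] : Fin 2 → ℂ) ≠ 0 := by
    intro a a' ha h0
    have h1 := congrFun h0 0
    have h2 := congrFun h0 1
    simp at h1 h2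
    simp [h1, h2] at ha
  -- These annihilate `a`, `b`, `c`. Each term has at most one primed factor, so any two of the
  -- functionals meet an annihilated one.
  refine ⟨![a 1, -a 0], ![b 1, -b 0], ![c 1, -c 0], ne _ _ ha, ne _ _ hb, ne _ _ hc, ?_, ?_, ?_⟩ <;>
  · intro i
    simp only [Fin.sum_univ_two, e]
    simp
    ring

theorem HasIrreducibleForm.contract {ψ : QState 4} (h : ψ.HasIrreducibleForm) (a : Fin 4)
    {w : Fin 2 → ℂ} (hw : w ≠ 0) : IsWClass (contract a w ψ) := by
  -- Completing `w` to an invertible matrix with first row `w` turns the contraction into the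
  -- component along `|0⟩`.
  obtain ⟨M, hM⟩ : ∃ M : Matrix.GeneralLinearGroup (Fin 2) ℂ, M.1 0 = w := by
    by_cases h0 : w 0 = 0
    · have h1 : w 1 ≠ 0 := by
        intro h1
        apply hw
        ext i
        fin_cases i <;> simp [h0, h1]
      refine ⟨Matrix.GeneralLinearGroup.mkOfDetNeZero !![w 0, w 1; 1, 0] ?_, ?_⟩
      · simp [Matrix.det_fin_two, h1]
      · ext i; fin_cases i <;> rfl
    · refine ⟨Matrix.GeneralLinearGroup.mkOfDetNeZero !![w 0, w 1; 0, 1] ?_, ?_⟩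
      · simp [Matrix.det_fin_two, h0]
      · ext i; fin_cases i <;> rfl
  have := (h a M).1
  convert this using 1
  ext y
  simp only [QState.contract, component, applyAt, Fin.insertNth_apply_same, hM]
  refine Finset.sum_congr rfl fun c _ => ?_
  congr 2
  simp

/-- A vector that is a product over some bipartition of the qubits. -/
def IsBiseparable {n : ℕ} (φ : QState n) : Prop :=
  ∃ T : Set (Fin n), T.Nonempty ∧ Tᶜ.Nonempty ∧
    ∃ f g : QState n, DependsOn f T ∧ DependsOn g Tᶜ ∧ φ = f * g

/-- A linear combination of two product vectors. -/
def IsSumOfTwoProducts {n : ℕ} (φ : QState n) : Prop :=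
  ∃ (c d : ℂ) (p q : Fin n → Fin 2 → ℂ),
    φ = fun y => c * ∏ i, p i (y i) + d * ∏ i, q i (y i)

/-- The hyperdeterminant of `c p + d q` is the square of `c d` times the three determinants of the
pairs `p i, q i`. When it vanishes, so does the slice determinant along some qubit. -/
theorem IsWClass.not_isSumOfTwoProducts {φ : QState 3} (h : IsWClass φ) :
    ¬ IsSumOfTwoProducts φ := by
  rintro ⟨c, d, p, q, e⟩
  have e' : ∀ i j k, arr φ i j k = c * (p 0 i * p 1 j * p 2 k) + d * (q 0 i * q 1 j * q 2 k) := by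
    intro i j k
    simp [arr, e, Fin.prod_univ_three]
  have hh := h.hyperdet_eq_zero
  obtain ⟨w, hw⟩ := h.sliceDet_ne
  obtain ⟨w', hw'⟩ := h.sliceDet_rot_ne
  simp only [hyperdet, sliceDet, rot, e'] at hh hw hw'
  have hh' : (c * d * (p 0 0 * q 0 1 - p 0 1 * q 0 0) * (p 1 0 * q 1 1 - p 1 1 * q 1 0)
      * (p 2 0 * q 2 1 - p 2 1 * q 2 0)) ^ 2 = 0 := by
    linear_combination hh
  have h0 := pow_eq_zero_iff (two_ne_zero) |>.1 hh'
  rcases mul_eq_zero.1 h0 with h0 | h2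
  · rcases mul_eq_zero.1 h0 with h0 | h1
    · apply hw'
      linear_combination (w' 0 * p 1 0 + w' 1 * p 1 1) * (w' 0 * q 1 0 + w' 1 * q 1 1)
        * (p 2 0 * q 2 1 - p 2 1 * q 2 0) * h0
    · apply hw
      linear_combination c * d * (w 0 * p 0 0 + w 1 * p 0 1) * (w 0 * q 0 0 + w 1 * q 0 1)
        * (p 2 0 * q 2 1 - p 2 1 * q 2 0) * h1
  · apply hw
    linear_combination c * d * (w 0 * p 0 0 + w 1 * p 0 1) * (w 0 * q 0 0 + w 1 * q 0 1)
        * (p 1 0 * q 1 1 - p 1 1 * q 1 0) * h2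

/-- If `f` does not depend on index `2` and `g` does not depend on index `1`, and one of them does
not depend on index `0`, the contractions of index `0` of the product have rank one. -/
theorem sliceDet_mul_eq_zero {f g : Fin 2 → Fin 2 → Fin 2 → ℂ} (w : Fin 2 → ℂ)
    (hf : ∀ i j k, f i j k = f i j 0) (hg : ∀ i j k, g i j k = g i 0 k)
    (h : (∀ i j k, f i j k = f 0 j k) ∨ ∀ i j k, g i j k = g 0 j k) :
    sliceDet (fun i j k => f i j k * g i j k) w = 0 := by
  rcases h with h | h
  · have hf' : ∀ i j k, f i j k = f 0 j 0 := fun i j k => (hf i j k).trans (h i j 0)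
    simp only [sliceDet, hf' _ 0 _, hf' _ 1 _, hg _ 1 _]
    ring
  · have hg' : ∀ i j k, g i j k = g 0 0 k := fun i j k => (hg i j k).trans (h i 0 k)
    simp only [sliceDet, hg' _ _ 0, hg' _ _ 1, hf _ _ 1]
    ring

theorem sliceDet_swap (f : Fin 2 → Fin 2 → Fin 2 → ℂ) (w : Fin 2 → ℂ) :
    sliceDet (fun i j k => f i k j) w = sliceDet f w := by
  simp only [sliceDet]
  ring

theorem IsWClass.not_isBiseparable {φ : QState 3} (h : IsWClass φ) : ¬ IsBiseparable φ := by
  rintro ⟨T, hT, hT', f, g, hf, hg, e⟩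
  obtain ⟨j, hj⟩ := hT
  obtain ⟨k, hk⟩ := hT'
  -- With `j` and `k` on opposite sides of the bipartition and `l` the third qubit, contracting `l`
  -- leaves a matrix of rank at most one. The map `σ` moves `l` to the front.
  have key : ∀ (σ : Fin 2 → Fin 2 → Fin 2 → Fin 3 → Fin 2) (l : Fin 3),
      (∀ a b c d, ∀ m ≠ k, σ a b c m = σ a b d m) → (∀ a b c d, ∀ m ≠ j, σ a b c m = σ a d c m) →
      (∀ a b c d, ∀ m ≠ l, σ a b c m = σ d b c m) →
      ∀ w, sliceDet (fun a b c => φ (σ a b c)) w = 0 := by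
    intro σ l h1 h2 h3 w
    rw [e]
    refine sliceDet_mul_eq_zero (f := fun a b c => f (σ a b c)) (g := fun a b c => g (σ a b c)) w
      (fun a b c => hf fun m hm => h1 _ _ _ _ _ ?_) (fun a b c => hg fun m hm => h2 _ _ _ _ _ ?_) ?_
    · rintro rfl; exact hk hm
    · rintro rfl; exact hm hj
    · by_cases hl : l ∈ T
      · refine .inr fun a b c => hg fun m hm => h3 _ _ _ _ _ ?_
        rintro rfl; exact hm hl
      · refine .inl fun a b c => hf fun m hm => h3 _ _ _ _ _ ?_
        rintro rfl; exact hl hm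
  have hjk : j ≠ k := by rintro rfl; exact hk hj
  obtain ⟨w0, h0⟩ := h.sliceDet_ne
  obtain ⟨w1, h1⟩ := h.sliceDet_rot_ne
  obtain ⟨w2, h2⟩ := h.sliceDet_rot'_ne
  have dec : ∀ (σ : Fin 2 → Fin 2 → Fin 2 → Fin 3 → Fin 2) (l : Fin 3),
      ((∀ a b c d, ∀ m ≠ k, σ a b c m = σ a b d m) ∧
      (∀ a b c d, ∀ m ≠ j, σ a b c m = σ a d c m) ∧
      (∀ a b c d, ∀ m ≠ l, σ a b c m = σ d b c m)) →
      ∀ w, sliceDet (fun a b c => φ (σ a b c)) w = 0 :=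
    fun σ l hh => key σ l hh.1 hh.2.1 hh.2.2
  fin_cases j <;> fin_cases k
  · exact hjk rfl
  · exact h2 (dec (fun a b c => ![b, c, a]) 2 (by decide) w2)
  · exact h1 (dec (fun a b c => ![b, a, c]) 1 (by decide) w1)
  · exact h2 ((sliceDet_swap _ _).symm.trans (dec (fun a b c => ![c, b, a]) 2 (by decide) w2))
  · exact hjk rfl
  · exact h0 (dec (fun a b c => ![a, b, c]) 0 (by decide) w0)
  · exact h1 ((sliceDet_swap _ _).symm.trans (dec (fun a b c => ![c, a, b]) 1 (by decide) w1))
  · exact h0 ((sliceDet_swap _ _).symm.trans (dec (fun a b c => ![a, c, b]) 0 (by decide) w0))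
  · exact hjk rfl

end QState

/-! ### Leaf counts of binary trees -/

namespace QTree

/-- `Desc s S f`: the vector `f` of the qubits in `S` is built from `s` single-qubit vectors by
binary sums and tensor products. -/
inductive Desc {n : ℕ} : ℕ → Finset (Fin n) → QState n → Prop
  | leaf (i : Fin n) (v : Fin 2 → ℂ) : Desc 1 {i} (fun x => v (x i))
  | add {a b : ℕ} {S : Finset (Fin n)} {f g : QState n} :
      Desc a S f → Desc b S g → Desc (a + b) S (f + g)
  | mul {a b : ℕ} {S T : Finset (Fin n)} {f g : QState n} :
      Disjoint S T → Desc a S f → Desc b T g → Desc (a + b) (S ∪ T) (f * g)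

namespace Desc

variable {n : ℕ}

theorem sum {S : Finset (Fin n)} : ∀ {k : ℕ} {s : Fin (k + 1) → ℕ} {f : Fin (k + 1) → QState n},
    (∀ j, Desc (s j) S (f j)) → Desc (∑ j, s j) S (∑ j, f j)
  | 0, s, f, h => by simpa using h 0
  | k + 1, s, f, h => by
    rw [Fin.sum_univ_succ, Fin.sum_univ_succ f]
    exact (h 0).add (sum fun j => h j.succ)

theorem prod : ∀ {k : ℕ} {P : Fin (k + 1) → Finset (Fin n)} {s : Fin (k + 1) → ℕ}
    {f : Fin (k + 1) → QState n}, Pairwise (fun j l => Disjoint (P j) (P l)) →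
    (∀ j, Desc (s j) (P j) (f j)) → Desc (∑ j, s j) (Finset.univ.biUnion P) (∏ j, f j)
  | 0, P, s, f, _, h => by simpa [Finset.univ_unique] using h 0
  | k + 1, P, s, f, hP, h => by
    have hU : Finset.univ.biUnion P = P 0 ∪ Finset.univ.biUnion fun j => P (Fin.succ j) := by
      ext x
      simp [Fin.exists_fin_succ]
    rw [Fin.sum_univ_succ, Fin.prod_univ_succ f, hU]
    refine (h 0).mul ?_ (prod (fun i j hij => hP (by simpa using hij)) fun j => h j.succ)
    simp only [Finset.disjoint_biUnion_right]
    exact fun j _ => hP (Fin.succ_ne_zero j).symm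

theorem of_isOn : ∀ (t : QTree n) {S : Finset (Fin n)}, t.IsOn S → Desc t.size S t.eval
  | .leaf i v, S, h => by
    rw [IsOn] at h
    subst h
    rw [size, eval]
    exact .leaf i v
  | .add k c, S, h => by
    rw [IsOn] at h
    have := sum fun j => of_isOn (c j) (h j)
    rw [size, eval]
    convert this using 1
    ext x
    simp
  | .tensor k c, S, h => by
    rw [IsOn] at h
    obtain ⟨P, hP, rfl, h⟩ := h
    have := prod hP fun j => of_isOn (c j) (h j)
    rw [size, eval]
    convert this using 1
    ext x
    simp

variable {s : ℕ} {S : Finset (Fin n)} {f : QState n}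

theorem nonempty (h : Desc s S f) : S.Nonempty := by
  induction h with
  | leaf i v => simp
  | add _ _ h _ => exact h
  | mul _ _ _ h _ => exact h.mono Finset.subset_union_left

theorem card_le (h : Desc s S f) : S.card ≤ s := by
  induction h with
  | leaf i v => simp
  | add _ _ h _ => omega
  | mul _ _ _ h h' => exact (Finset.card_union_le _ _).trans (by omega)

theorem dependsOn (h : Desc s S f) : DependsOn f (S : Set (Fin n)) := by
  induction h with
  | leaf i v => intro x y hxy; simp [hxy i (by simp)]
  | add _ _ h h' => intro x y hxy; simp [h hxy, h' hxy]
  | mul _ _ _ h h' =>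
    intro x y hxy
    simp [h fun i hi => hxy i (by simp_all), h' fun i hi => hxy i (by simp_all)]

theorem exists_eq_of_singleton {i : Fin n} (h : Desc s {i} f) :
    ∃ v : Fin 2 → ℂ, f = fun x => v (x i) := by
  refine ⟨fun b => f fun _ => b, funext fun x => h.dependsOn fun j hj => ?_⟩
  simp at hj
  simp [hj]

/-- With at most one leaf more than qubits, only product vectors can be built. -/
theorem exists_eq_prod (h : Desc s S f) (hs : s ≤ S.card + 1) :
    ∃ v : Fin n → Fin 2 → ℂ, f = fun x => ∏ i ∈ S, v i (x i) := by
  induction h with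
  | leaf i v => exact ⟨fun _ => v, by simp⟩
  | @add a b S f g h h' _ _ =>
    have h1 := h.card_le
    have h2 := h'.card_le
    have h3 := h.nonempty.card_pos
    -- Both summands need `S.card` leaves, so `2 * S.card ≤ S.card + 1`.
    obtain ⟨i, rfl⟩ := Finset.card_eq_one.1 (show S.card = 1 by omega)
    obtain ⟨v, hv⟩ := (h.add h').exists_eq_of_singleton
    exact ⟨fun _ => v, by simpa using hv⟩
  | @mul a b S T f g hd h h' ih ih' =>
    have h1 := h.card_le
    have h2 := h'.card_le
    rw [Finset.card_union_of_disjoint hd] at hs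
    obtain ⟨v, rfl⟩ := ih (by omega)
    obtain ⟨v', rfl⟩ := ih' (by omega)
    refine ⟨fun i => if i ∈ S then v i else v' i, funext fun x => ?_⟩
    rw [Finset.prod_union hd, Pi.mul_apply]
    congr 1
    · exact Finset.prod_congr rfl fun i hi => by simp [hi]
    · exact Finset.prod_congr rfl fun i hi => by
        simp [Finset.disjoint_right.1 hd hi]

theorem cases_of_one_lt (h : Desc s S f) (hS : 1 < S.card) :
    (∃ a b g k, Desc a S g ∧ Desc b S k ∧ s = a + b ∧ f = g + k) ∨
    ∃ a b T U g k, Disjoint T U ∧ Desc a T g ∧ Desc b U k ∧ T ∪ U = S ∧ s = a + b ∧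
      f = g * k := by
  cases h with
  | leaf i v => simp at hS
  | add h h' => exact .inl ⟨_, _, _, _, h, h', rfl, rfl⟩
  | mul hd h h' => exact .inr ⟨_, _, _, _, _, _, hd, h, h', rfl, rfl, rfl⟩

end Desc

end QTree

/-! ### Lower bound: at least 16 leaves -/

namespace QState

open QTree

variable {n : ℕ}

/-- The amplitudes with qubit `a` set to `0`. -/
def restrict (a : Fin (n + 1)) (ψ : QState (n + 1)) : QState n :=
  fun y => ψ (a.insertNth (α := fun _ => Fin 2) 0 y)

theorem contract_add (a : Fin (n + 1)) (w : Fin 2 → ℂ) (ψ χ : QState (n + 1)) :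
    contract a w (ψ + χ) = contract a w ψ + contract a w χ := by
  ext y
  simp [contract, mul_add]
  ring

theorem contract_mul {a : Fin (n + 1)} (w : Fin 2 → ℂ) (f : QState (n + 1)) {g : QState (n + 1)}
    {S : Set (Fin (n + 1))} (hg : DependsOn g S) (ha : a ∉ S) :
    contract a w (f * g) = contract a w f * restrict a g := by
  ext y
  have : ∀ c, g (a.insertNth (α := fun _ => Fin 2) c y)
      = g (a.insertNth (α := fun _ => Fin 2) 0 y) := by
    refine fun c => hg fun i hi => ?_
    obtain ⟨j, rfl⟩ := Fin.exists_succAbove_eq (x := i) (y := a) (by rintro rfl; exact ha hi)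
    simp
  simp only [contract, restrict, Pi.mul_apply, this, Finset.sum_mul, mul_assoc]

theorem contract_leaf (a : Fin (n + 1)) (w v : Fin 2 → ℂ) :
    contract a w (fun x => v (x a)) = fun _ => ∑ c, w c * v c := by
  ext y
  simp [contract]

theorem dependsOn_insertNth {a : Fin (n + 1)} {f : QState (n + 1)} {S : Set (Fin (n + 1))}
    (hf : DependsOn f S) (c : Fin 2) :
    DependsOn (fun y => f (a.insertNth (α := fun _ => Fin 2) c y)) (a.succAbove ⁻¹' S) := by
  refine fun _ _ hxy => hf fun i hi => ?_
  induction i using a.succAboveCases with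
  | x => simp
  | p j => simpa using hxy j hi

theorem dependsOn_contract {a : Fin (n + 1)} {f : QState (n + 1)} {S : Set (Fin (n + 1))}
    (w : Fin 2 → ℂ) (hf : DependsOn f S) : DependsOn (contract a w f) (a.succAbove ⁻¹' S) :=
  fun _ _ hxy => Finset.sum_congr rfl fun c _ =>
    congrArg (w c * ·) (dependsOn_insertNth hf c hxy)

theorem isBiseparable_mul {f g : QState n} {S T : Set (Fin n)} (hf : DependsOn f S)
    (hg : DependsOn g T) (hS : S.Nonempty) (hT : T.Nonempty) (hd : Disjoint S T) :
    IsBiseparable (f * g) := by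
  have hsub : T ⊆ Sᶜ := fun i hi hi' => hd.le_bot ⟨hi', hi⟩
  exact ⟨S, hS, hT.mono hsub, f, g, hf, fun x y hxy => hg fun i hi => hxy i (hsub hi), rfl⟩

theorem IsBiseparable.smul {φ : QState n} (h : IsBiseparable φ) (c : ℂ) :
    IsBiseparable (c • φ) := by
  obtain ⟨T, h1, h2, f, g, hf, hg, rfl⟩ := h
  refine ⟨T, h1, h2, c • f, g, fun x y hxy => ?_, hg, by rw [smul_mul_assoc]⟩
  simp [hf hxy]

theorem IsSumOfTwoProducts.smul {φ : QState n} (h : IsSumOfTwoProducts φ) (c : ℂ) :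
    IsSumOfTwoProducts (c • φ) := by
  obtain ⟨d, e, p, q, rfl⟩ := h
  refine ⟨c * d, c * e, p, q, funext fun y => ?_⟩
  simp only [Pi.smul_apply, smul_eq_mul]
  ring

theorem preimage_succAbove_nonempty {a : Fin (n + 1)} {S : Finset (Fin (n + 1))}
    (hS : S.Nonempty) (h : S ≠ {a}) : (a.succAbove ⁻¹' (S : Set (Fin (n + 1)))).Nonempty := by
  by_contra h0
  apply h
  refine (Finset.eq_singleton_iff_nonempty_unique_mem).2 ⟨hS, fun i hi => ?_⟩
  by_contra hia
  obtain ⟨j, rfl⟩ := Fin.exists_succAbove_eq hia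
  exact h0 ⟨j, hi⟩

theorem contract_prod (a : Fin (n + 1)) (w : Fin 2 → ℂ) (v : Fin (n + 1) → Fin 2 → ℂ) :
    contract a w (fun x => ∏ i, v i (x i))
      = fun y => (∑ c, w c * v a c) * ∏ i, v (a.succAbove i) (y i) := by
  ext y
  simp only [contract, Fin.prod_univ_succAbove _ a, Fin.insertNth_apply_same,
    Fin.insertNth_apply_succAbove, Finset.sum_mul, mul_assoc]

theorem restrict_prod_erase (a : Fin (n + 1)) (v : Fin (n + 1) → Fin 2 → ℂ) :
    restrict a (fun x => ∏ i ∈ Finset.univ.erase a, v i (x i))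
      = fun y => ∏ i, v (a.succAbove i) (y i) := by
  ext y
  have : (Finset.univ.erase a : Finset (Fin (n + 1)))
      = Finset.univ.map (Fin.succAboveEmb a) := by
    ext i
    simp [Fin.exists_succAbove_eq_iff]
  simp [restrict, this]

/-- A vector of three qubits with at most seven leaves is degenerate. -/
theorem isDegenerate_restrict {a : Fin 4} {s : ℕ} {χ : QState 4}
    (h : Desc s (Finset.univ.erase a) χ) (hs : s ≤ 7) :
    IsBiseparable (restrict a χ) ∨ IsSumOfTwoProducts (restrict a χ) := by
  have hc : (Finset.univ.erase a).card = 3 := by simp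
  rcases h.cases_of_one_lt (by omega) with
    ⟨c, d, g, k, hg, hk, rfl, rfl⟩ | ⟨c, d, T, U, g, k, hd, hg, hk, hTU, rfl, rfl⟩
  · right
    have h1 := hg.card_le
    have h2 := hk.card_le
    -- Each summand has at least 3 of the at most 7 leaves, hence at most 4, and is a product
    -- vector.
    obtain ⟨p, rfl⟩ := hg.exists_eq_prod (by omega)
    obtain ⟨q, rfl⟩ := hk.exists_eq_prod (by omega)
    refine ⟨1, 1, fun i => p (a.succAbove i), fun i => q (a.succAbove i), ?_⟩
    have hp := restrict_prod_erase a p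
    have hq := restrict_prod_erase a q
    ext y
    have hp' := congrFun hp y
    have hq' := congrFun hq y
    simp only [restrict, Pi.add_apply, one_mul] at hp' hq' ⊢
    rw [hp', hq']
  · left
    have haT : T ≠ {a} := by
      rintro rfl
      have : a ∈ Finset.univ.erase a := hTU ▸ by simp
      simp at this
    have haU : U ≠ {a} := by
      rintro rfl
      have : a ∈ Finset.univ.erase a := hTU ▸ by simp
      simp at this
    exact isBiseparable_mul (dependsOn_insertNth hg.dependsOn 0)
      (dependsOn_insertNth hk.dependsOn 0) (preimage_succAbove_nonempty hg.nonempty haT)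
      (preimage_succAbove_nonempty hk.nonempty haU)
      (Disjoint.preimage _ (by exact_mod_cast hd))

theorem exists_annihilator (u : Fin 2 → ℂ) : ∃ w : Fin 2 → ℂ, w ≠ 0 ∧ ∑ c, w c * u c = 0 := by
  by_cases hu : u = 0
  · exact ⟨![1, 0], fun h => by simpa using congrFun h 0, by simp [hu]⟩
  · refine ⟨![u 1, -u 0], fun h => hu ?_, by simp; ring⟩
    have h0 := congrFun h 0
    have h1 := congrFun h 1
    simp at h0 h1
    ext i
    fin_cases i <;> simp [h0, h1]

/-- The contraction of a product over `S ∪ T` along a qubit of `S` with `S ≠ {a}`. -/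
theorem isBiseparable_contract_mul {a : Fin (n + 1)} (w : Fin 2 → ℂ) {s t : ℕ}
    {S T : Finset (Fin (n + 1))} {f g : QState (n + 1)} (hf : Desc s S f) (hg : Desc t T g)
    (hd : Disjoint S T) (ha : a ∈ S) (hS : S ≠ {a}) : IsBiseparable (contract a w (f * g)) := by
  have haT : a ∉ T := Finset.disjoint_left.1 hd ha
  rw [contract_mul w f hg.dependsOn (by simpa using haT)]
  refine isBiseparable_mul (dependsOn_contract w hf.dependsOn) (dependsOn_insertNth hg.dependsOn 0)
      (preimage_succAbove_nonempty hf.nonempty hS) (preimage_succAbove_nonempty hg.nonempty ?_)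
      (Disjoint.preimage _ (by exact_mod_cast hd))
  rintro rfl
  simp at haT

theorem contract_leaf_mul {a : Fin (n + 1)} (w u : Fin 2 → ℂ) {g : QState (n + 1)}
    {S : Finset (Fin (n + 1))} {t : ℕ} (hg : Desc t S g) (ha : a ∉ S) :
    contract a w ((fun x => u (x a)) * g) = (∑ c, w c * u c) • restrict a g := by
  rw [contract_mul w _ hg.dependsOn (by simpa using ha), contract_leaf]
  ext y
  simp

theorem not_isWClass_zero : ¬ IsWClass 0 := by
  intro h
  refine h.not_isSumOfTwoProducts ⟨0, 0, 0, 0, ?_⟩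
  ext y
  simp

namespace HasIrreducibleForm

variable {ψ : QState 4}

theorem ne_mul (h : ψ.HasIrreducibleForm) {s t : ℕ} {S T : Finset (Fin 4)} {f g : QState 4}
    (hf : Desc s S f) (hg : Desc t T g) (hd : Disjoint S T) : ψ ≠ f * g := by
  rintro rfl
  obtain ⟨a, ha⟩ := hf.nonempty
  by_cases hS : S = {a}
  · subst hS
    obtain ⟨u, rfl⟩ := hf.exists_eq_of_singleton
    obtain ⟨w, hw, hwu⟩ := exists_annihilator u
    have := h.contract a hw
    rw [contract_leaf_mul w u hg (Finset.disjoint_left.1 hd ha), hwu, zero_smul] at this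
    exact not_isWClass_zero this
  · have hw : (![1, 0] : Fin 2 → ℂ) ≠ 0 := fun h => by simpa using congrFun h 0
    exact (h.contract a hw).not_isBiseparable (isBiseparable_contract_mul _ hf hg hd ha hS)

/-- Annihilating `u` leaves a contraction of `f * g`, biseparable unless `S = {a}`. In that case
annihilating the factor of `f` leaves a multiple of `χ`, degenerate since it has at most 7 leaves.
-/
theorem ne_leaf_mul_add_mul (h : ψ.HasIrreducibleForm) {a : Fin 4} {u : Fin 2 → ℂ} {c s t : ℕ}
    {χ : QState 4} (hχ : Desc c (Finset.univ.erase a) χ) (hc : c ≤ 7)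
    {S T : Finset (Fin 4)} {f g : QState 4} (hf : Desc s S f) (hg : Desc t T g)
    (hd : Disjoint S T) (ha : a ∈ S) : ψ ≠ (fun x => u (x a)) * χ + f * g := by
  rintro rfl
  obtain ⟨w, hw, hwu⟩ := exists_annihilator u
  by_cases hS : S = {a}
  · subst hS
    obtain ⟨v, rfl⟩ := hf.exists_eq_of_singleton
    obtain ⟨w', hw', hwv⟩ := exists_annihilator v
    have := h.contract a hw'
    rw [contract_add, contract_leaf_mul w' v hg (Finset.disjoint_left.1 hd ha), hwv, zero_smul,
      add_zero, contract_leaf_mul w' u hχ (by simp)] at this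
    rcases isDegenerate_restrict hχ hc with hb | hb
    · exact this.not_isBiseparable (hb.smul _)
    · exact this.not_isSumOfTwoProducts (hb.smul _)
  · have := h.contract a hw
    rw [contract_add, contract_leaf_mul w u hχ (by simp), hwu, zero_smul, zero_add] at this
    exact this.not_isBiseparable (isBiseparable_contract_mul _ hf hg hd ha hS)

theorem ne_prod_add_prod_add_leaf_mul (h : ψ.HasIrreducibleForm) {a : Fin 4} {u : Fin 2 → ℂ}
    {c : ℕ} {χ : QState 4} (hχ : Desc c (Finset.univ.erase a) χ) (p q : Fin 4 → Fin 2 → ℂ) :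
    ψ ≠ (fun x => ∏ i, p i (x i)) + (fun x => ∏ i, q i (x i)) + (fun x => u (x a)) * χ := by
  rintro rfl
  obtain ⟨w, hw, hwu⟩ := exists_annihilator u
  have := h.contract a hw
  rw [contract_add, contract_add, contract_leaf_mul w u hχ (by simp), hwu, zero_smul, add_zero,
    contract_prod, contract_prod] at this
  exact this.not_isSumOfTwoProducts ⟨_, _, _, _, rfl⟩

end HasIrreducibleForm

/-- A product over a bipartition of four qubits with at most seven leaves splits off a qubit. -/
theorem exists_eq_leaf_mul_of_mul {s t : ℕ} {S T : Finset (Fin 4)} {f g : QState 4}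
    (hf : Desc s S f) (hg : Desc t T g) (hd : Disjoint S T) (hST : S ∪ T = Finset.univ)
    (hs : s + t ≤ 7) : ∃ (a : Fin 4) (u : Fin 2 → ℂ) (c : ℕ) (χ : QState 4),
      Desc c (Finset.univ.erase a) χ ∧ c ≤ 7 ∧ f * g = (fun x => u (x a)) * χ := by
  wlog hle : s ≤ t generalizing s t S T f g
  · obtain ⟨a, u, c, χ, h⟩ := this hg hf hd.symm (by rw [Finset.union_comm, hST]) (by omega)
      (by omega)
    exact ⟨a, u, c, χ, by rwa [mul_comm f g]⟩
  have hcard : S.card + T.card = 4 := by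
    rw [← Finset.card_union_of_disjoint hd, hST]; simp
  have h1 := hf.card_le
  have h2 := hg.card_le
  have h3 := hf.nonempty.card_pos
  have h4 := hg.nonempty.card_pos
  -- The cheaper factor has at most 3 leaves, too few for anything but a product vector on two or
  -- more qubits.
  obtain ⟨v, hv⟩ : ∃ v : Fin 4 → Fin 2 → ℂ, f = fun x => ∏ i ∈ S, v i (x i) := by
    by_cases hS : S.card = 1
    · obtain ⟨i, rfl⟩ := Finset.card_eq_one.1 hS
      obtain ⟨v, hv⟩ := hf.exists_eq_of_singleton
      exact ⟨fun _ => v, by simpa using hv⟩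
    · exact hf.exists_eq_prod (by omega)
  obtain ⟨a, ha⟩ := hf.nonempty
  have hfa : f = (fun x => v a (x a)) * fun x => ∏ i ∈ S.erase a, v i (x i) := by
    rw [hv]
    ext x
    rw [Pi.mul_apply, Finset.mul_prod_erase S (fun i => v i (x i)) ha]
  have haT : a ∉ T := Finset.disjoint_left.1 hd ha
  have herase : (S.erase a) ∪ T = Finset.univ.erase a := by
    rw [← hST, Finset.erase_union_distrib, Finset.erase_eq_of_notMem haT]
  have hprod : ∀ U : Finset (Fin 4), U.Nonempty →
      Desc U.card U (fun x => ∏ i ∈ U, v i (x i)) := by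
    intro U hU
    induction hU using Finset.Nonempty.cons_induction with
    | singleton i => simpa using Desc.leaf i (v i)
    | cons i U hi hU ih =>
      have := (Desc.leaf i (v i)).mul (by simpa using hi) ih
      rw [Finset.card_cons, Finset.cons_eq_insert, Finset.insert_eq, add_comm]
      convert this using 1
      ext x
      rw [← Finset.insert_eq, Finset.prod_insert hi]
      rfl
  by_cases hSa : (S.erase a).Nonempty
  · refine ⟨a, v a, _, _, herase ▸ Desc.mul (hd.mono_left (Finset.erase_subset _ _))
      (hprod _ hSa) hg, ?_, by rw [← mul_assoc, ← hfa]⟩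
    rw [Finset.card_erase_of_mem ha]
    omega
  · rw [Finset.not_nonempty_iff_eq_empty] at hSa
    rw [hSa] at herase hfa
    refine ⟨a, v a, t, g, by rw [← herase]; simpa using hg, by omega, ?_⟩
    rw [hfa]
    ext x
    simp

theorem exists_eq_leaf_mul {s : ℕ} {f : QState 4} (h : Desc s Finset.univ f) (hs : s ≤ 7) :
    ∃ (a : Fin 4) (u : Fin 2 → ℂ) (c : ℕ) (χ : QState 4),
      Desc c (Finset.univ.erase a) χ ∧ c ≤ 7 ∧ f = (fun x => u (x a)) * χ := by
  rcases h.cases_of_one_lt (by simp) with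
    ⟨c, d, g, k, hg, hk, rfl, rfl⟩ | ⟨c, d, T, U, g, k, hd, hg, hk, hTU, rfl, rfl⟩
  · have h1 := hg.card_le
    have h2 := hk.card_le
    simp at h1 h2
    omega
  · exact exists_eq_leaf_mul_of_mul hg hk hd hTU hs

namespace HasIrreducibleForm

variable {ψ : QState 4}

theorem ne_add_add (h : ψ.HasIrreducibleForm) {a b c : ℕ} {f g k : QState 4}
    (hf : Desc a Finset.univ f) (hg : Desc b Finset.univ g) (hk : Desc c Finset.univ k)
    (ha : a ≤ 5) (hb : b ≤ 5) (hc : c ≤ 7) : ψ ≠ f + g + k := by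
  obtain ⟨p, rfl⟩ := hf.exists_eq_prod (by simpa using ha)
  obtain ⟨q, rfl⟩ := hg.exists_eq_prod (by simpa using hb)
  obtain ⟨i, u, d, χ, hχ, -, rfl⟩ := exists_eq_leaf_mul hk hc
  exact h.ne_prod_add_prod_add_leaf_mul hχ p q

theorem sixteen_le (h : ψ.HasIrreducibleForm) {s : ℕ} (hs : Desc s Finset.univ ψ) : 16 ≤ s := by
  by_contra! hlt
  rcases hs.cases_of_one_lt (by simp) with
    ⟨a, b, f, g, hf, hg, rfl, e⟩ | ⟨c, d, T, U, g, k, hd, hg, hk, hTU, rfl, e⟩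
  · wlog hab : a ≤ b generalizing a b f g
    · exact this b a g f hg hf (by rw [e, add_comm]) (by rwa [add_comm b a]) (by omega) (by omega)
    have ha4 := hf.card_le
    simp at ha4
    rcases hg.cases_of_one_lt (by simp) with
      ⟨b, c, g, k, hg', hk, rfl, rfl⟩ | ⟨s, t, S, T, g, k, hd, hg', hk, hST, rfl, rfl⟩
    · have hb4 := hg'.card_le
      have hc4 := hk.card_le
      simp at hb4 hc4
      -- Three summands of at least 4 leaves each, at most 15 in all: two of them have at most 5,
      -- since 6 + 6 + 4 = 16, and the third has at most 7.
      by_cases h1 : a ≤ 5 ∧ b ≤ 5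
      · exact h.ne_add_add hf hg' hk h1.1 h1.2 (by omega) (by rw [e, add_assoc])
      by_cases h2 : a ≤ 5 ∧ c ≤ 5
      · exact h.ne_add_add hf hk hg' h2.1 h2.2 (by omega) (by rw [e]; abel)
      · exact h.ne_add_add hg' hk hf (by omega) (by omega) (by omega) (by rw [e]; abel)
    · obtain ⟨i, u, c, χ, hχ, hc, rfl⟩ := exists_eq_leaf_mul hf (by omega)
      rcases Finset.mem_union.1 (hST ▸ Finset.mem_univ i) with hi | hi
      · exact h.ne_leaf_mul_add_mul hχ hc hg' hk hd hi e
      · exact h.ne_leaf_mul_add_mul hχ hc hk hg' hd.symm hi (by rw [e, mul_comm g k])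
  · exact h.ne_mul hg hk hd e

end HasIrreducibleForm

end QState

/-! ### Biquadratic forms that are squares -/

namespace QState

open QTree

/-- The value of the binary quadratic form with coefficients `a`. -/
def quad (a : Fin 3 → ℂ) (s t : ℂ) : ℂ := a 0 * s ^ 2 + a 1 * (s * t) + a 2 * t ^ 2

theorem exists_quad_eq_zero (a : Fin 3 → ℂ) : ∃ s t : ℂ, (s ≠ 0 ∨ t ≠ 0) ∧ quad a s t = 0 := by
  by_cases h : a 0 = 0
  · exact ⟨1, 0, by simp, by simp [quad, h]⟩
  · obtain ⟨d, hd⟩ := IsAlgClosed.exists_pow_nat_eq (a 1 ^ 2 - 4 * a 0 * a 2) two_pos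
    refine ⟨(-a 1 + d) / (2 * a 0), 1, by simp, ?_⟩
    simp only [quad]
    field_simp
    linear_combination hd

theorem quad_eq_zero_or {p q : Fin 3 → ℂ} (h : ∀ s t, quad p s t * quad q s t = 0) :
    (∀ s t, quad p s t = 0) ∨ ∀ s t, quad q s t = 0 := by
  open Polynomial in
  let P : (Fin 3 → ℂ) → ℂ[X] := fun a => C (a 0) * X ^ 2 + C (a 1) * X + C (a 2)
  have hP : P p * P q = 0 := by
    refine Polynomial.funext fun r => ?_
    simpa [P, quad] using h r 1
  have hz : ∀ a, P a = 0 → ∀ s t, quad a s t = 0 := by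
    intro a ha s t
    have h0 := congrArg (Polynomial.coeff · 0) ha
    have h1 := congrArg (Polynomial.coeff · 1) ha
    have h2 := congrArg (Polynomial.coeff · 2) ha
    simp [P, Polynomial.coeff_X, Polynomial.coeff_C] at h0 h1 h2
    simp [quad, h0, h1, h2]
  exact (mul_eq_zero.1 hP).imp (hz p) (hz q)

/-- At a zero of `a`, also `b` vanishes, while `c` does not. Along a line through that point `b²`
vanishes to second order, so `a` does too: its zero is double. -/
theorem disc_eq_zero {a b c : Fin 3 → ℂ}
    (h : ∀ s t, quad b s t ^ 2 = 4 * quad a s t * quad c s t)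
    (hne : ∀ s t, s ≠ 0 ∨ t ≠ 0 → quad a s t = 0 → quad b s t = 0 → quad c s t ≠ 0) :
    a 1 ^ 2 = 4 * a 0 * a 2 := by
  obtain ⟨s, t, hst, ha⟩ := exists_quad_eq_zero a
  have hb : quad b s t = 0 := by
    have := h s t
    rw [ha] at this
    simpa using this
  have hc := hne s t hst ha hb
  obtain ⟨s', t', hD⟩ : ∃ s' t', s * t' - t * s' ≠ 0 := by
    rcases hst with h | h
    · exact ⟨0, 1, by simpa using h⟩
    · exact ⟨1, 0, by simpa using h⟩
  let pol : (Fin 3 → ℂ) → ℂ := fun a =>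
    2 * a 0 * (s * s') + a 1 * (s * t' + t * s') + 2 * a 2 * (t * t')
  have hexp : ∀ a r, quad a (s + r * s') (t + r * t')
      = quad a s t + r * pol a + r ^ 2 * quad a s' t' := by
    intro a r
    simp only [quad, pol]
    ring
  have hr : ∀ r : ℂ, (r * pol b + r ^ 2 * quad b s' t') ^ 2
      = 4 * (r * pol a + r ^ 2 * quad a s' t')
        * (quad c s t + r * pol c + r ^ 2 * quad c s' t') := by
    intro r
    have := h (s + r * s') (t + r * t')
    rw [hexp, hexp, hexp, ha, hb] at this
    linear_combination this
  have hpol : pol a * quad c s t = 0 := by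
    -- This central difference extracts the linear coefficient in `r` of an identity of degree 4.
    linear_combination (-8 * hr 1 + 8 * hr (-1) + hr 2 - hr (-2)) / 48
  have hpa : pol a = 0 := (mul_eq_zero.1 hpol).resolve_right hc
  have : (s * t' - t * s') ^ 2 * (a 1 ^ 2 - 4 * a 0 * a 2) = 0 := by
    have e : (s * t' - t * s') ^ 2 * (a 1 ^ 2 - 4 * a 0 * a 2)
        = pol a ^ 2 - 4 * quad a s t * quad a s' t' := by
      simp only [pol, quad]
      ring
    rw [e, ha, hpa]
    ring
  exact sub_eq_zero.1 ((mul_eq_zero.1 this).resolve_left (pow_ne_zero 2 hD))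

theorem exists_quad_eq_sq {a : Fin 3 → ℂ} (h : a 1 ^ 2 = 4 * a 0 * a 2) :
    ∃ p q : ℂ, ∀ s t, quad a s t = (p * s + q * t) ^ 2 := by
  obtain ⟨p, hp⟩ := IsAlgClosed.exists_pow_nat_eq (a 0) two_pos
  obtain ⟨q, hq⟩ := IsAlgClosed.exists_pow_nat_eq (a 2) two_pos
  have : (a 1 - 2 * p * q) * (a 1 + 2 * p * q) = 0 := by
    linear_combination h - 4 * p ^ 2 * hq - 4 * a 2 * hp
  rcases mul_eq_zero.1 this with h1 | h1
  · exact ⟨p, q, fun s t => by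
      simp only [quad]; linear_combination s * t * h1 - s ^ 2 * hp - t ^ 2 * hq⟩
  · exact ⟨p, -q, fun s t => by
      simp only [quad]; linear_combination s * t * h1 - s ^ 2 * hp - t ^ 2 * hq⟩

/-- A biquadratic form that is a nonzero square in the second variable for every nonzero value of
the first is the square of a nondegenerate bilinear form. -/
theorem exists_bilinear_sq {a b c : Fin 3 → ℂ}
    (h : ∀ s t, quad b s t ^ 2 = 4 * quad a s t * quad c s t)
    (hne : ∀ s t, s ≠ 0 ∨ t ≠ 0 → quad a s t = 0 → quad b s t = 0 → quad c s t ≠ 0) :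
    ∃ p q p' q' : ℂ, p * q' - q * p' ≠ 0 ∧ ∀ s t x y,
      quad a s t * x ^ 2 + quad b s t * (x * y) + quad c s t * y ^ 2
        = (x * (p * s + q * t) + y * (p' * s + q' * t)) ^ 2 := by
  obtain ⟨p, q, ha⟩ := exists_quad_eq_sq (disc_eq_zero h hne)
  obtain ⟨p', q', hc⟩ := exists_quad_eq_sq (disc_eq_zero (a := c) (b := b) (c := a)
    (fun s t => by rw [h]; ring) fun s t hst h1 h2 h3 => hne s t hst h3 h2 h1)
  obtain ⟨p', q', hc, hb⟩ : ∃ p' q' : ℂ, (∀ s t, quad c s t = (p' * s + q' * t) ^ 2) ∧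
      ∀ s t, quad b s t = 2 * (p * s + q * t) * (p' * s + q' * t) := by
    let m : Fin 3 → ℂ := ![2 * p * p', 2 * (p * q' + q * p'), 2 * q * q']
    have hm : ∀ s t, quad m s t = 2 * (p * s + q * t) * (p' * s + q' * t) := by
      intro s t
      simp [quad, m]
      ring
    have hsub : ∀ s t, quad (b - m) s t = quad b s t - quad m s t := by
      intro s t
      simp only [quad, Pi.sub_apply]
      ring
    have hadd : ∀ s t, quad (b + m) s t = quad b s t + quad m s t := by
      intro s t
      simp only [quad, Pi.add_apply]
      ring
    have : ∀ s t, quad (b - m) s t * quad (b + m) s t = 0 := by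
      intro s t
      rw [hsub, hadd, hm]
      have := h s t
      rw [ha, hc] at this
      linear_combination this
    -- So `b = m` or `b = -m` identically; the sign is absorbed into `p'` and `q'`.
    rcases quad_eq_zero_or this with h1 | h1
    · exact ⟨p', q', hc, fun s t => by rw [← hm]; linear_combination h1 s t - hsub s t⟩
    · refine ⟨-p', -q', fun s t => by rw [hc]; ring, fun s t => ?_⟩
      have := h1 s t
      rw [hadd, hm] at this
      linear_combination this
  refine ⟨p, q, p', q', fun hD => ?_, fun s t x y => by rw [ha, hb, hc]; ring⟩
  obtain ⟨s, t, hst, h1, h2⟩ : ∃ s t : ℂ, (s ≠ 0 ∨ t ≠ 0) ∧ p * s + q * t = 0 ∧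
      p' * s + q' * t = 0 := by
    by_cases hpq : p = 0 ∧ q = 0
    · by_cases hpq' : p' = 0 ∧ q' = 0
      · exact ⟨1, 0, by simp, by simp [hpq], by simp [hpq']⟩
      · refine ⟨q', -p', ?_, by simp [hpq], by ring⟩
        by_contra! h0
        exact hpq' ⟨by simpa using h0.2, h0.1⟩
    · refine ⟨q, -p, ?_, by ring, by linear_combination -hD⟩
      by_contra! h0
      exact hpq ⟨by simpa using h0.2, h0.1⟩
  exact hne s t hst (by rw [ha, h1]; ring) (by rw [hb, h1]; ring) (by rw [hc, h2]; ring)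

/-! ### Pencils of W-class arrays and the normal form -/

/-- The contraction of the first index of a four-index array. -/
def pencil (g : Fin 2 → Fin 2 → Fin 2 → Fin 2 → ℂ) (v : Fin 2 → ℂ) (i j k : Fin 2) : ℂ :=
  v 0 * g 0 i j k + v 1 * g 1 i j k

/-- In a pencil of W-class arrays, the degenerate direction `w` of an index depends linearly on the
parameter `v` of the pencil. -/
theorem exists_linear_kernel (g : Fin 2 → Fin 2 → Fin 2 → Fin 2 → ℂ)
    (h : ∀ v : Fin 2 → ℂ, v ≠ 0 → hyperdet (pencil g v) = 0)
    (hne : ∀ v : Fin 2 → ℂ, v ≠ 0 → ∃ w, sliceDet (pencil g v) w ≠ 0) :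
    ∃ N : Matrix (Fin 2) (Fin 2) ℂ, N.det ≠ 0 ∧ ∀ v w : Fin 2 → ℂ, v ≠ 0 → w ≠ 0 →
      sliceDet (pencil g v) w = 0 → ∃ c : ℂ, ∀ i, ∑ b, v b * N b i = c * w i := by
  let a : Fin 3 → ℂ := ![g 0 0 0 0 * g 0 0 1 1 - g 0 0 0 1 * g 0 0 1 0,
    g 0 0 0 0 * g 1 0 1 1 + g 1 0 0 0 * g 0 0 1 1
      - g 0 0 0 1 * g 1 0 1 0 - g 1 0 0 1 * g 0 0 1 0,
    g 1 0 0 0 * g 1 0 1 1 - g 1 0 0 1 * g 1 0 1 0]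
  let c : Fin 3 → ℂ := ![g 0 1 0 0 * g 0 1 1 1 - g 0 1 0 1 * g 0 1 1 0,
    g 0 1 0 0 * g 1 1 1 1 + g 1 1 0 0 * g 0 1 1 1
      - g 0 1 0 1 * g 1 1 1 0 - g 1 1 0 1 * g 0 1 1 0,
    g 1 1 0 0 * g 1 1 1 1 - g 1 1 0 1 * g 1 1 1 0]
  let b : Fin 3 → ℂ := ![g 0 0 0 0 * g 0 1 1 1 + g 0 1 0 0 * g 0 0 1 1
      - g 0 0 0 1 * g 0 1 1 0 - g 0 1 0 1 * g 0 0 1 0,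
    g 0 0 0 0 * g 1 1 1 1 + g 1 0 0 0 * g 0 1 1 1 + g 0 1 0 0 * g 1 0 1 1 + g 1 1 0 0 * g 0 0 1 1
      - g 0 0 0 1 * g 1 1 1 0 - g 1 0 0 1 * g 0 1 1 0 - g 0 1 0 1 * g 1 0 1 0
      - g 1 1 0 1 * g 0 0 1 0,
    g 1 0 0 0 * g 1 1 1 1 + g 1 1 0 0 * g 1 0 1 1 - g 1 0 0 1 * g 1 1 1 0 - g 1 1 0 1 * g 1 0 1 0]
  have hs : ∀ v w, sliceDet (pencil g v) w = quad a (v 0) (v 1) * (w 0) ^ 2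
      + quad b (v 0) (v 1) * (w 0 * w 1) + quad c (v 0) (v 1) * (w 1) ^ 2 := by
    intro v w
    simp [sliceDet, pencil, quad, a, b, c]
    ring
  have hh : ∀ v, hyperdet (pencil g v) = quad b (v 0) (v 1) ^ 2
      - 4 * quad a (v 0) (v 1) * quad c (v 0) (v 1) := by
    intro v
    simp [hyperdet, pencil, quad, a, b, c]
    ring
  have hv : ∀ s t : ℂ, s ≠ 0 ∨ t ≠ 0 → (![s, t] : Fin 2 → ℂ) ≠ 0 := by
    intro s t hst h0
    have h1 := congrFun h0 0
    have h2 := congrFun h0 1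
    simp at h1 h2
    simp [h1, h2] at hst
  obtain ⟨p, q, p', q', hD, hsq⟩ := exists_bilinear_sq (a := a) (b := b) (c := c)
    (by
      intro s t
      by_cases hst : s ≠ 0 ∨ t ≠ 0
      · have := h _ (hv s t hst)
        rw [hh] at this
        simpa [sub_eq_zero] using this
      · push Not at hst
        simp [quad, hst])
    (by
      intro s t hst h1 h2 h3
      obtain ⟨w, hw⟩ := hne _ (hv s t hst)
      rw [hs] at hw
      simp [h1, h2, h3] at hw)
  -- The row vector `v N` is the root of the linear form in `w` whose square is the slice
  -- determinant.
  refine ⟨!![p', -p; q', -q], by rw [Matrix.det_fin_two_of]; intro h0; apply hD; linear_combination h0,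
    fun v w _ hw h0 => ?_⟩
  rw [hs, hsq] at h0
  have h0 := pow_eq_zero_iff (two_ne_zero) |>.1 h0
  by_cases hw0 : w 0 = 0
  · have hw1 : w 1 ≠ 0 := by
      intro hw1
      apply hw
      ext i
      fin_cases i <;> simp [hw0, hw1]
    refine ⟨-(p * v 0 + q * v 1) / w 1, fun i => ?_⟩
    fin_cases i
    · have : p' * v 0 + q' * v 1 = 0 := by simpa [hw0, hw1] using h0
      simp [hw0]
      linear_combination this
    · simp
      field_simp
      ring
  · refine ⟨(p' * v 0 + q' * v 1) / w 0, fun i => ?_⟩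
    fin_cases i
    · simp
      field_simp
    · simp
      field_simp
      linear_combination -h0

/-- An array with three vanishing cubic contractions is a combination of two pairings of
singlets. -/
theorem exists_singlets (G : Fin 2 → Fin 2 → Fin 2 → Fin 2 → ℂ)
    (h1 : ∀ (v : Fin 2 → ℂ) d, ∑ a, ∑ b, ∑ c, v a * v b * v c * G a b c d = 0)
    (h2 : ∀ (v : Fin 2 → ℂ) c, ∑ a, ∑ b, ∑ d, v a * v b * v d * G a b c d = 0)
    (h3 : ∀ (v : Fin 2 → ℂ) b, ∑ a, ∑ c, ∑ d, v a * v c * v d * G a b c d = 0) :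
    ∃ (p q : ℂ), ∀ a b c d, G a b c d
      = p * (!![0, 1; -1, 0] a b * !![0, 1; -1, 0] c d)
        + q * (!![0, 1; -1, 0] a c * !![0, 1; -1, 0] b d) := by
  have key : ∀ F : Fin 2 → Fin 2 → Fin 2 → ℂ,
      (∀ v : Fin 2 → ℂ, ∑ a, ∑ b, ∑ c, v a * v b * v c * F a b c = 0) →
      F 0 0 0 = 0 ∧ F 1 1 1 = 0 ∧ F 0 0 1 + F 0 1 0 + F 1 0 0 = 0 ∧
        F 0 1 1 + F 1 0 1 + F 1 1 0 = 0 := by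
    intro F hF
    have e0 := hF ![1, 0]
    have e1 := hF ![0, 1]
    have e2 := hF ![1, 1]
    have e3 := hF ![1, -1]
    simp [Fin.sum_univ_two] at e0 e1 e2 e3
    refine ⟨e0, e1, ?_, ?_⟩
    · linear_combination (e2 - e3) / 2 - e1
    · linear_combination (e2 + e3) / 2 - e0
  have k1 := fun d => key (fun a b c => G a b c d) fun v => h1 v d
  have k2 := fun c => key (fun a b d => G a b c d) fun v => h2 v c
  have k3 := fun b => key (fun a c d => G a b c d) fun v => h3 v b
  obtain ⟨a1, a2, a3, a4⟩ := k1 0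
  obtain ⟨a5, a6, a7, a8⟩ := k1 1
  obtain ⟨b1, b2, b3, b4⟩ := k2 0
  obtain ⟨b5, b6, b7, b8⟩ := k2 1
  obtain ⟨c1, c2, c3, c4⟩ := k3 0
  obtain ⟨c5, c6, c7, c8⟩ := k3 1
  -- At each of these two entries exactly one of the two pairings is nonzero, with value 1.
  refine ⟨G 0 1 0 1, G 0 0 1 1, fun a b c d => ?_⟩
  fin_cases a <;> fin_cases b <;> fin_cases c <;> fin_cases d <;> simp <;> grind

theorem eq_sum_inv {N : Matrix (Fin 2) (Fin 2) ℂ} (hN : N.det ≠ 0) (f : Fin 2 → ℂ) (j : Fin 2) :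
    f j = ∑ b, N⁻¹ j b * ∑ i, N b i * f i := by
  have : N⁻¹.mulVec (N.mulVec f) = f := by
    rw [Matrix.mulVec_mulVec, Matrix.nonsing_inv_mul _ (isUnit_iff_ne_zero.2 hN), Matrix.one_mulVec]
  exact (congrFun this j).symm

theorem contract_zero_eq (ψ : QState 4) (v : Fin 2 → ℂ) :
    arr (contract 0 v ψ) = pencil (fun a i j k => ψ ![a, i, j, k]) v := by
  ext i j k
  simp [arr, contract, pencil]

/-- The slice along `x` is a matrix with the nonzero vector `y` in its kernel. -/
theorem sliceDet_eq_zero_of_kernel {f : Fin 2 → Fin 2 → Fin 2 → ℂ} {x y : Fin 2 → ℂ} (hy : y ≠ 0)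
    (h : ∀ k, ∑ i, ∑ j, x i * y j * f i j k = 0) : sliceDet f x = 0 := by
  simp only [Fin.sum_univ_two] at h
  have h0 : y 0 * sliceDet f x = 0 := by
    simp only [sliceDet]
    linear_combination (x 0 * f 0 1 1 + x 1 * f 1 1 1) * h 0
      - (x 0 * f 0 1 0 + x 1 * f 1 1 0) * h 1
  have h1 : y 1 * sliceDet f x = 0 := by
    simp only [sliceDet]
    linear_combination (x 0 * f 0 0 0 + x 1 * f 1 0 0) * h 1
      - (x 0 * f 0 0 1 + x 1 * f 1 0 1) * h 0
  by_contra hD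
  apply hy
  ext i
  fin_cases i
  · exact (mul_eq_zero.1 h0).resolve_right hD
  · exact (mul_eq_zero.1 h1).resolve_right hD

/-- The normal form of the vectors with irreducible `A|BCD` form. -/
theorem HasIrreducibleForm.exists_normal_form {ψ : QState 4} (h : ψ.HasIrreducibleForm) :
    ∃ e₁ e₂ e₃ e₄ : Fin 2 → Fin 2 → ℂ, ∀ a b c d,
      ψ ![a, b, c, d] = e₁ a b * e₂ c d + e₃ a c * e₄ b d := by
  set g : Fin 2 → Fin 2 → Fin 2 → Fin 2 → ℂ := fun a i j k => ψ ![a, i, j, k]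
  have hW : ∀ v : Fin 2 → ℂ, v ≠ 0 → ∃ φ, IsWClass φ ∧ arr φ = pencil g v :=
    fun v hv => ⟨_, h.contract 0 hv, contract_zero_eq ψ v⟩
  obtain ⟨N₁, hN₁, k₁⟩ := exists_linear_kernel g
    (fun v hv => by obtain ⟨φ, hφ, e⟩ := hW v hv; rw [← e]; exact hφ.hyperdet_eq_zero)
    (fun v hv => by obtain ⟨φ, hφ, e⟩ := hW v hv; rw [← e]; exact hφ.sliceDet_ne)
  obtain ⟨N₂, hN₂, k₂⟩ := exists_linear_kernel (fun a => rot (g a))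
    (fun v hv => by
      obtain ⟨φ, hφ, e⟩ := hW v hv
      have := hφ.hyperdet_eq_zero
      rw [e] at this
      rw [← this]
      simp only [hyperdet, pencil, rot]
      ring)
    (fun v hv => by
      obtain ⟨φ, hφ, e⟩ := hW v hv
      have := hφ.sliceDet_rot_ne
      rwa [e] at this)
  obtain ⟨N₃, hN₃, k₃⟩ := exists_linear_kernel (fun a => rot' (g a))
    (fun v hv => by
      obtain ⟨φ, hφ, e⟩ := hW v hv
      have := hφ.hyperdet_eq_zero
      rw [e] at this
      rw [← this]
      simp only [hyperdet, pencil, rot']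
      ring)
    (fun v hv => by
      obtain ⟨φ, hφ, e⟩ := hW v hv
      have := hφ.sliceDet_rot'_ne
      rwa [e] at this)
  -- The degenerate functionals of the contraction by `v` may be replaced by their multiples `v N₁`,
  -- `v N₂`, `v N₃`, so the relations become cubic in `v`.
  have hker : ∀ v : Fin 2 → ℂ,
      (∀ k, ∑ i, ∑ j, (∑ b, v b * N₁ b i) * (∑ b, v b * N₂ b j) * pencil g v i j k = 0) ∧
      (∀ j, ∑ i, ∑ k, (∑ b, v b * N₁ b i) * (∑ b, v b * N₃ b k) * pencil g v i j k = 0) ∧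
      (∀ i, ∑ j, ∑ k, (∑ b, v b * N₂ b j) * (∑ b, v b * N₃ b k) * pencil g v i j k = 0) := by
    intro v
    by_cases hv : v = 0
    · simp [hv]
    obtain ⟨φ, hφ, e⟩ := hW v hv
    obtain ⟨x, y, z, hx, hy, hz, e1, e2, e3⟩ := hφ.exists_kernel
    rw [e] at e1 e2 e3
    have swap : ∀ (x y : Fin 2 → ℂ) (f : Fin 2 → Fin 2 → ℂ), ∑ i, ∑ j, x i * y j * f i j = 0 →
        ∑ j, ∑ i, y j * x i * f i j = 0 := by
      intro x y f hf
      rw [Finset.sum_comm]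
      simpa only [mul_comm] using hf
    obtain ⟨r, hr⟩ := k₁ v x hv hx (sliceDet_eq_zero_of_kernel (f := pencil g v) hy e1)
    obtain ⟨s, hs⟩ := k₂ v y hv hy (sliceDet_eq_zero_of_kernel (f := rot (pencil g v)) hx
      fun k => swap x y (fun i j => pencil g v i j k) (e1 k))
    obtain ⟨t, ht⟩ := k₃ v z hv hz (sliceDet_eq_zero_of_kernel (f := rot' (pencil g v)) hx
      fun j => swap x z (fun i k => pencil g v i j k) (e2 j))
    simp only [Fin.sum_univ_two] at e1 e2 e3
    simp only [hr, hs, ht]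
    refine ⟨fun k => ?_, fun k => ?_, fun k => ?_⟩ <;> simp only [Fin.sum_univ_two]
    · linear_combination r * s * e1 k
    · linear_combination r * t * e2 k
    · linear_combination s * t * e3 k
  let G₁ : Fin 2 → Fin 2 → Fin 2 → Fin 2 → ℂ := fun a b k l => ∑ j, N₁ b j * g a j k l
  let G₂ : Fin 2 → Fin 2 → Fin 2 → Fin 2 → ℂ := fun a b c l => ∑ k, N₂ c k * G₁ a b k l
  let G₃ : Fin 2 → Fin 2 → Fin 2 → Fin 2 → ℂ := fun a b c d => ∑ l, N₃ d l * G₂ a b c l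
  obtain ⟨p, q, hG⟩ := exists_singlets G₃
    (by
      intro v d
      have h0 := (hker v).1 0
      have h1 := (hker v).1 1
      simp only [Fin.sum_univ_two, pencil, G₁, G₂, G₃] at h0 h1 ⊢
      linear_combination N₃ d 0 * h0 + N₃ d 1 * h1)
    (by
      intro v c
      have h0 := (hker v).2.1 0
      have h1 := (hker v).2.1 1
      simp only [Fin.sum_univ_two, pencil, G₁, G₂, G₃] at h0 h1 ⊢
      linear_combination N₂ c 0 * h0 + N₂ c 1 * h1)
    (by
      intro v b
      have h0 := (hker v).2.2 0
      have h1 := (hker v).2.2 1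
      simp only [Fin.sum_univ_two, pencil, G₁, G₂, G₃] at h0 h1 ⊢
      linear_combination N₁ b 0 * h0 + N₁ b 1 * h1)
  have hinv : ∀ a j k l, g a j k l
      = ∑ b, N₁⁻¹ j b * ∑ c, N₂⁻¹ k c * ∑ d, N₃⁻¹ l d * G₃ a b c d := by
    intro a j k l
    rw [eq_sum_inv hN₁ (fun j => g a j k l) j]
    refine Finset.sum_congr rfl fun b _ => congrArg _ ?_
    refine (eq_sum_inv hN₂ (fun k => G₁ a b k l) k).trans ?_
    refine Finset.sum_congr rfl fun c _ => congrArg _ ?_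
    exact eq_sum_inv hN₃ (fun l => G₂ a b c l) l
  let ε : Matrix (Fin 2) (Fin 2) ℂ := !![0, 1; -1, 0]
  refine ⟨fun a j => p * ∑ b, N₁⁻¹ j b * ε a b,
    fun k l => ∑ c, N₂⁻¹ k c * ∑ d, N₃⁻¹ l d * ε c d,
    fun a k => q * ∑ c, N₂⁻¹ k c * ε a c,
    fun j l => ∑ b, N₁⁻¹ j b * ∑ d, N₃⁻¹ l d * ε b d, fun a j k l => ?_⟩
  refine (hinv a j k l).trans ?_
  simp only [hG, ε, Fin.sum_univ_two]
  ring

end QState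

/-! ### Upper bound: the tree with 16 leaves -/

namespace QTree

open QState

/-- A tree `T_E` for a two-qubit vector. -/
def ofPair {n : ℕ} (i j : Fin n) (h : Fin 2 → Fin 2 → ℂ) : QTree n :=
  add 0 ![tensor 0 ![leaf i ![1, 0], leaf j (h 0)], tensor 0 ![leaf i ![0, 1], leaf j (h 1)]]

theorem isTE_ofPair {n : ℕ} (i j : Fin n) (h : Fin 2 → Fin 2 → ℂ) : (ofPair i j h).IsTE :=
  ⟨i, j, i, j, _, _, _, _, rfl⟩

theorem eval_ofPair {n : ℕ} (i j : Fin n) (h : Fin 2 → Fin 2 → ℂ) (x : Fin n → Fin 2) :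
    (ofPair i j h).eval x = h (x i) (x j) := by
  generalize hb : x i = b
  fin_cases b <;> simp [ofPair, eval, hb]

theorem isOn_tensor {n : ℕ} {s t : QTree n} {S T : Finset (Fin n)} (hs : s.IsOn S)
    (ht : t.IsOn T) (hd : Disjoint S T) : (tensor 0 ![s, t]).IsOn (S ∪ T) := by
  refine ⟨![S, T], ?_, ?_, ?_⟩
  · intro i j hij
    fin_cases i <;> fin_cases j <;> simp_all [disjoint_comm]
  · ext x
    simp
  · intro j
    fin_cases j
    · exact hs
    · exact ht

theorem isOn_add {n : ℕ} {s t : QTree n} {S : Finset (Fin n)} (hs : s.IsOn S)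
    (ht : t.IsOn S) : (add 0 ![s, t]).IsOn S := by
  intro j
  fin_cases j
  · exact hs
  · exact ht

theorem isOn_ofPair {n : ℕ} {i j : Fin n} (hij : i ≠ j) (h : Fin 2 → Fin 2 → ℂ) :
    (ofPair i j h).IsOn ({i} ∪ {j}) :=
  isOn_add (isOn_tensor rfl rfl (by simpa using hij)) (isOn_tensor rfl rfl (by simpa using hij))

theorem size_ofPair {n : ℕ} (i j : Fin n) (h : Fin 2 → Fin 2 → ℂ) : (ofPair i j h).size = 4 := by
  simp [ofPair, size]

end QTree

open QTree QState in
theorem QState.HasIrreducibleForm.exists_tree {ψ : QState 4} (h : ψ.HasIrreducibleForm) :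
    ∃ t : QTree 4, t.IsT8AddT8 ∧ t.Describes ψ ∧ t.size = 16 := by
  obtain ⟨e₁, e₂, e₃, e₄, he⟩ := h.exists_normal_form
  refine ⟨.add 0 ![.tensor 0 ![ofPair 0 1 e₁, ofPair 2 3 e₂],
    .tensor 0 ![ofPair 0 2 e₃, ofPair 1 3 e₄]],
    ⟨_, _, ⟨_, _, isTE_ofPair _ _ _, isTE_ofPair _ _ _, rfl⟩,
      ⟨_, _, isTE_ofPair _ _ _, isTE_ofPair _ _ _, rfl⟩, rfl⟩, ⟨isOn_add ?_ ?_, ?_⟩, ?_⟩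
  · exact (by decide : ({0} ∪ {1} ∪ ({2} ∪ {3}) : Finset (Fin 4)) = Finset.univ) ▸
      isOn_tensor (isOn_ofPair (by decide) e₁) (isOn_ofPair (by decide) e₂) (by decide)
  · exact (by decide : ({0} ∪ {2} ∪ ({1} ∪ {3}) : Finset (Fin 4)) = Finset.univ) ▸
      isOn_tensor (isOn_ofPair (by decide) e₃) (isOn_ofPair (by decide) e₄) (by decide)
  · ext x
    have hx : x = ![x 0, x 1, x 2, x 3] := by
      ext i
      fin_cases i <;> rfl
    conv_rhs => rw [hx, he]
    simp [eval, eval_ofPair]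
  · simp [size, size_ofPair]

theorem proposition5 (ψ : QState 4) (hψ : ψ.HasIrreducibleForm) :
    (∃ t : QTree 4, t.IsT8AddT8 ∧ t.IsMinimalFor ψ) ∧ treeSize ψ = 16 := by
  obtain ⟨t, h8, ht, hs⟩ := hψ.exists_tree
  have hmin : ∀ t' : QTree 4, t'.Describes ψ → 16 ≤ t'.size := fun t' ht' =>
    hψ.sixteen_le (ht'.2 ▸ QTree.Desc.of_isOn t' ht'.1)
  refine ⟨⟨t, h8, ht, fun t' ht' => hs ▸ hmin t' ht'⟩, le_antisymm ?_ ?_⟩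
  · exact Nat.sInf_le ⟨t, ht, hs⟩
  · refine le_csInf ⟨16, t, ht, hs⟩ ?_
    rintro s ⟨t', ht', rfl⟩
    exact hmin t' ht'
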